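/- Let $d\ge 0$ and let $\mathbb H^d=\{x\in\mathbb R^d:\|x\|<1\}$ be $d$-dimensional hyperbolic space (curvature $-1$) in the Poincaré ball model, with distance $$d_{\mathbb H}(x,y)=\operatorname{arccosh}\Bigl(1+\frac{2\|x-y\|^2}{(1-\|x\|^2)(1-\|y\|^2)}\Bigr)$$ and Riemannian norm $\|v\|_{\mathbb H}=2\|v\|/(1-\|x\|^2)$ for a tangent vector $v$ at $x$. The length of a smooth path $\gamma:[a,b]\to\mathbb H^d$ is $\operatorname{length}(\gamma)=\int_a^b\|\dot\gamma(t)\|_{\mathbb H}\,dt$. Let $M\subset\mathbb H^d$ be a nonempty totally geodesic submanifold, i.e. $M$ contains every complete geodesic line through two distinct points of $M$. Every $x\in\mathbb H^d$ has a unique closest point $\pi_M(x)$ in $M$. Let $\gamma:[a,b]\to\mathbb H^d$ be a smooth path, or a geodesic segment parametrized by arc length (i.e. $d_{\mathbb H}(\gamma(s),\gamma(t))=|s-t|$ for all $s,t\in[a,b]$). Then $\gamma$ and $\pi_M\circ\gamma$ are smooth, and: 1. If $r\ge 0$ and $d_{\mathbb H}(\gamma(t),M)\ge r$ for all $t\in[a,b]$,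 then $$\operatorname{length}(\pi_M\circ\gamma)\le\frac{1}{\cosh r}\operatorname{length}(\gamma);$$ in particular the shrink factor grows exponentially with $r$: $\operatorname{length}(\pi_M\circ\gamma)\le 2e^{-r}\operatorname{length}(\gamma)$. 2. If $\gamma$ is not constant and not entirely contained in $M$, then $\operatorname{length}(\pi_M\circ\gamma)<\operatorname{length}(\gamma)$. -/

import Mathlib

open scoped ContDiff

noncomputable section

namespace Hyp

/-- The underlying set of the Poincaré ball model of `d`-dimensional hyperbolic space:
the open Euclidean unit ball. -/
def ball (d : ℕ) : Set (EuclideanSpace ℝ (Fin d)) := Metric.ball 0 1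

/-- The hyperbolic distance in the Poincaré ball (curvature `-1`). -/
def hdist {d : ℕ} (x y : EuclideanSpace ℝ (Fin d)) : ℝ :=
  Real.arcosh (1 + 2 * (‖x - y‖ ^ 2 / ((1 - ‖x‖ ^ 2) * (1 - ‖y‖ ^ 2))))

/-- The Riemannian norm of a tangent vector `v` at the point `x` of the Poincaré ball. -/
def tangentNorm {d : ℕ} (x v : EuclideanSpace ℝ (Fin d)) : ℝ :=
  2 * ‖v‖ / (1 - ‖x‖ ^ 2)

/-- A smooth path in hyperbolic space parametrized by `[a, b]`. -/
def IsSmoothPath {d : ℕ} (γ : ℝ → EuclideanSpace ℝ (Fin d)) (a b : ℝ) : Prop :=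
  (∀ t ∈ Set.Icc a b, γ t ∈ ball d) ∧ ContDiffOn ℝ ∞ γ (Set.Icc a b)

/-- The Riemannian length of a path parametrized by `[a, b]`. -/
def length {d : ℕ} (γ : ℝ → EuclideanSpace ℝ (Fin d)) (a b : ℝ) : ℝ :=
  ∫ t in a..b, tangentNorm (γ t) (derivWithin γ (Set.Icc a b) t)

/-- A geodesic segment: a shortest path, parametrized by arc length on `[a, b]`. -/
def IsGeodesicSegment {d : ℕ} (γ : ℝ → EuclideanSpace ℝ (Fin d)) (a b : ℝ) : Prop :=
  (∀ t ∈ Set.Icc a b, γ t ∈ ball d) ∧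
    ∀ s ∈ Set.Icc a b, ∀ t ∈ Set.Icc a b, hdist (γ s) (γ t) = |s - t|

/-- A complete geodesic line, parametrized by arc length. -/
def IsGeodesicLine {d : ℕ} (γ : ℝ → EuclideanSpace ℝ (Fin d)) : Prop :=
  (∀ t, γ t ∈ ball d) ∧ ∀ s t, hdist (γ s) (γ t) = |s - t|

/-- `M` is a (nonempty) totally geodesic submanifold of hyperbolic space: it contains every
geodesic line through two distinct points of it. (In hyperbolic space such a set is
automatically a properly embedded smooth submanifold, so this need not be assumed.) -/
def IsTotallyGeodesic {d : ℕ} (M : Set (EuclideanSpace ℝ (Fin d))) : Prop :=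
  M.Nonempty ∧ M ⊆ ball d ∧
    ∀ γ : ℝ → EuclideanSpace ℝ (Fin d), IsGeodesicLine γ →
      ∀ s t : ℝ, s ≠ t → γ s ∈ M → γ t ∈ M → ∀ u : ℝ, γ u ∈ M

/-- The distance from the point `x` to the set `M`. -/
def distTo {d : ℕ} (x : EuclideanSpace ℝ (Fin d)) (M : Set (EuclideanSpace ℝ (Fin d))) : ℝ :=
  sInf (hdist x '' M)

/-- `y` is a point of `M` closest to `x`. -/
def IsClosestPoint {d : ℕ} (M : Set (EuclideanSpace ℝ (Fin d)))
    (x y : EuclideanSpace ℝ (Fin d)) : Prop :=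
  y ∈ M ∧ ∀ z ∈ M, hdist x y ≤ hdist x z

/-- The closest-point (geodesic) projection onto `M`; it is a closest point whenever there
is one. -/
def proj {d : ℕ} (M : Set (EuclideanSpace ℝ (Fin d))) (x : EuclideanSpace ℝ (Fin d)) :
    EuclideanSpace ℝ (Fin d) :=
  Classical.epsilon (IsClosestPoint M x)

end Hyp

end

/-! In the hyperboloid model the problem becomes linear algebra for the Lorentz form `lor`: the
hyperbolic cosine of a distance is `lor u v`, and the Riemannian metric is `-lor` on tangent
vectors. A totally geodesic set is the intersection of the hyperboloid with a linear subspace `W`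
(`IsLineClosed.exists_submodule`). Since `W` contains a timelike vector, there is a
Lorentz-orthogonal projection `T` onto it, and the closest point to `u` is `T u` rescaled to the
hyperboloid (`isClosestPoint_foot`).

Put `q = lor (T u) (T u)`; then `√q` is the hyperbolic cosine of the distance from `u` to `M`.
Applying `T` drops the component normal to `W`, and rescaling contributes the factor `1 / √q`.
Cauchy-Schwarz on normal components shows that velocities shrink by at least this factor
(`IsLorProj.footDeriv_le`). Integration gives the bound on lengths.

For strictness, `q > 1` off `M`, so equality of lengths forces the path to be stationary whenever it
is off `M`. Such a path keeps a constant distance to `M`; if it is ever off `M`, it is always off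
`M`, hence constant (`eq_left_of_stationary_off`). -/

namespace Hyp

/-! ### Lorentz geometry and linear sections of the hyperboloid. -/

section Lorentz

variable {V : Type*} [NormedAddCommGroup V] [InnerProductSpace ℝ V]

/-- The Lorentz form of signature `(+, -, …, -)` on `V × ℝ`, the last coordinate being time. -/
noncomputable def lor : LinearMap.BilinForm ℝ (V × ℝ) :=
  LinearMap.mk₂ ℝ (fun u v => u.2 * v.2 - inner ℝ u.1 v.1)
    (fun u v w => by simp only [Prod.snd_add, Prod.fst_add, inner_add_left]; ring)
    (fun c u v => by
      simp only [Prod.smul_snd, Prod.smul_fst, real_inner_smul_left, smul_eq_mul]; ring)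
    (fun u v w => by simp only [Prod.snd_add, Prod.fst_add, inner_add_right]; ring)
    (fun c u v => by
      simp only [Prod.smul_snd, Prod.smul_fst, real_inner_smul_right, smul_eq_mul]; ring)

lemma lor_apply (u v : V × ℝ) : lor u v = u.2 * v.2 - inner ℝ u.1 v.1 := rfl

lemma lor_self (u : V × ℝ) : lor u u = u.2 ^ 2 - ‖u.1‖ ^ 2 := by
  rw [lor_apply, real_inner_self_eq_norm_sq]; ring

lemma lor_comm (u v : V × ℝ) : lor u v = lor v u := by
  rw [lor_apply, lor_apply, real_inner_comm, mul_comm]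

lemma isRefl_lor : (lor (V := V)).IsRefl := fun u v h => by rw [lor_comm, h]

/-- The upper sheet of the unit hyperboloid. -/
def sheet (V : Type*) [NormedAddCommGroup V] [InnerProductSpace ℝ V] : Set (V × ℝ) :=
  {u | lor u u = 1 ∧ 0 < u.2}

/-- The Lorentz complement of a timelike vector is spacelike. -/
lemma lor_self_neg {X u : V × ℝ} (hX : 0 < lor X X) (h : lor X u = 0) (hu : u ≠ 0) :
    lor u u < 0 := by
  rw [lor_self] at hX ⊢
  rw [lor_apply] at h
  have hX2 : 0 < X.2 ^ 2 := by nlinarith [sq_nonneg ‖X.1‖]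
  -- Orthogonality identifies the spatial inner product with `X.2 * u.2`, so Cauchy-Schwarz bounds
  -- `u.2` in terms of `‖u.1‖`.
  have hcs := abs_real_inner_le_norm X.1 u.1
  rw [← sub_eq_zero.mp h] at hcs
  have hcs2 : (X.2 * u.2) ^ 2 ≤ (‖X.1‖ * ‖u.1‖) ^ 2 := by
    rw [← sq_abs (X.2 * u.2)]; gcongr
  by_cases h1 : u.1 = 0
  · rw [h1] at h
    have h2 : u.2 = 0 := by
      rcases mul_eq_zero.mp (by simpa using h : X.2 * u.2 = 0) with h3 | h3
      · rw [h3] at hX2; norm_num at hX2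
      · exact h3
    exact absurd (Prod.ext h1 h2) hu
  · have h3 : 0 < ‖u.1‖ ^ 2 := by positivity
    by_contra! hc
    nlinarith [mul_pos (sub_pos.mpr (by linarith : ‖X.1‖ ^ 2 < X.2 ^ 2)) h3]

lemma lor_self_nonpos {X u : V × ℝ} (hX : 0 < lor X X) (h : lor X u = 0) : lor u u ≤ 0 := by
  by_cases hu : u = 0
  · simp [hu]
  · exact (lor_self_neg hX h hu).le

lemma eq_zero_of_lor_self {X u : V × ℝ} (hX : 0 < lor X X) (h : lor X u = 0)
    (h0 : 0 ≤ lor u u) : u = 0 := by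
  by_contra hu
  exact absurd (lor_self_neg hX h hu) (not_lt.mpr h0)

/-- The Cauchy-Schwarz inequality on the Lorentz complement of a timelike vector. -/
lemma lor_sq_le {X u v : V × ℝ} (hX : 0 < lor X X) (hu : lor X u = 0) (hv : lor X v = 0) :
    lor u v ^ 2 ≤ lor u u * lor v v := by
  by_cases h0 : u = 0
  · simp [h0]
  have h1 := lor_self_neg hX hu h0
  -- Gram-Schmidt: this vector has Lorentz square `lor u u * (lor u u * lor v v - lor u v ^ 2)`, and
  -- `lor u u < 0`.
  have h2 := lor_self_nonpos (u := lor u u • v - lor u v • u) hX (by simp [hu, hv])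
  simp only [map_sub, map_smul, LinearMap.sub_apply, LinearMap.smul_apply, smul_eq_mul,
    lor_comm v u] at h2
  by_contra! hc
  nlinarith [mul_pos_of_neg_of_neg h1 (sub_neg.mpr hc)]

lemma norm_lt_of_lor_self_pos {u : V × ℝ} (h : 0 < lor u u) : ‖u.1‖ < |u.2| := by
  rw [lor_self] at h
  exact lt_of_pow_lt_pow_left₀ 2 (abs_nonneg _) (by rw [sq_abs]; linarith)

lemma lor_pos {u v : V × ℝ} (hu : 0 < lor u u) (hu2 : 0 < u.2) (hv : 0 < lor v v)
    (hv2 : 0 < v.2) : 0 < lor u v := by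
  have h1 := norm_lt_of_lor_self_pos hu
  have h2 := norm_lt_of_lor_self_pos hv
  rw [abs_of_pos hu2] at h1
  rw [abs_of_pos hv2] at h2
  have h3 := real_inner_le_norm u.1 v.1
  have h4 := mul_lt_mul'' h1 h2 (norm_nonneg _) (norm_nonneg _)
  rw [lor_apply]
  linarith

/-- If `v` pointed to the past, `lor_pos` applied to `-v` would reverse the sign. This is how
vectors built later are placed on the upper sheet. -/
lemma snd_pos_of_lor_pos {u v : V × ℝ} (hu : 0 < lor u u) (hu2 : 0 < u.2) (hv : 0 < lor v v)
    (h : 0 < lor u v) : 0 < v.2 := by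
  by_contra! hc
  rcases hc.lt_or_eq with hc | hc
  · have := lor_pos hu hu2 (v := -v) (by simpa using hv) (by simpa using hc)
    simp only [map_neg] at this
    linarith
  · have := norm_lt_of_lor_self_pos hv
    rw [hc, abs_zero] at this
    exact absurd this (not_lt.mpr (norm_nonneg _))

/-- The part of `v` orthogonal to `u` has Lorentz square `1 - lor u v ^ 2`, which cannot be
positive. -/
lemma one_le_lor {u v : V × ℝ} (hu : u ∈ sheet V) (hv : v ∈ sheet V) : 1 ≤ lor u v := by
  have hp : 0 < lor u v :=
    lor_pos (by rw [hu.1]; exact one_pos) hu.2 (by rw [hv.1]; exact one_pos) hv.2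
  have := lor_self_nonpos (X := u) (u := v - lor u v • u) (by rw [hu.1]; exact one_pos)
    (by simp [hu.1])
  simp only [map_sub, map_smul, LinearMap.sub_apply, LinearMap.smul_apply, smul_eq_mul,
    lor_comm v u, hu.1, hv.1] at this
  nlinarith

lemma eq_of_lor_le_one {u v : V × ℝ} (hu : u ∈ sheet V) (hv : v ∈ sheet V)
    (h : lor u v ≤ 1) : u = v := by
  have h1 : lor u v = 1 := le_antisymm h (one_le_lor hu hv)
  have := eq_zero_of_lor_self (X := u) (u := v - u) (by rw [hu.1]; exact one_pos)
    (by simp [hu.1, h1])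
    (by simp [hu.1, hv.1, h1, lor_comm v u])
  exact (sub_eq_zero.mp this).symm

lemma sq_sum_lor {u v : V × ℝ} (α β : ℝ) : lor (α • u + β • v) (α • u + β • v) =
    α ^ 2 * lor u u + 2 * (α * β) * lor u v + β ^ 2 * lor v v := by
  simp only [map_add, map_smul, LinearMap.add_apply, LinearMap.smul_apply, smul_eq_mul,
    lor_comm v u]
  ring

lemma normalize_mem_sheet {u : V × ℝ} (hu : 0 < lor u u) (hu2 : 0 < u.2) :
    (√(lor u u))⁻¹ • u ∈ sheet V := by
  have h := Real.sqrt_pos.mpr hu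
  refine ⟨?_, ?_⟩
  · simp only [map_smul, LinearMap.smul_apply, smul_eq_mul]
    nth_rw 3 [← Real.sq_sqrt hu.le]
    field_simp
  · simp only [Prod.smul_snd, smul_eq_mul]; positivity

/-- A subset of the hyperboloid that contains every point of the hyperboloid lying in the span of
two of its points. -/
def IsLineClosed (S : Set (V × ℝ)) : Prop :=
  ∀ X ∈ S, ∀ Y ∈ S, ∀ Z ∈ sheet V, ∀ α β : ℝ, Z = α • X + β • Y → Z ∈ S

lemma IsLineClosed.exists_add_eq {S : Set (V × ℝ)} (hS : S ⊆ sheet V) (hl : IsLineClosed S)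
    {X Y : V × ℝ} (hX : X ∈ S) (hY : Y ∈ S) {α β : ℝ} (hα : 0 < α) (hβ : 0 < β) :
    ∃ c : ℝ, 0 < c ∧ ∃ Z ∈ S, α • X + β • Y = c • Z := by
  have h1 := one_le_lor (hS hX) (hS hY)
  have hp : 0 < lor (α • X + β • Y) (α • X + β • Y) := by
    rw [sq_sum_lor, (hS hX).1, (hS hY).1]
    positivity
  have hp2 : 0 < (α • X + β • Y).2 := by
    simp only [Prod.snd_add, Prod.smul_snd, smul_eq_mul]
    have := (hS hX).2
    have := (hS hY).2
    positivity
  have hs := Real.sqrt_pos.mpr hp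
  refine ⟨_, hs, _, hl X hX Y hY _ (normalize_mem_sheet hp hp2) _ _
    (by rw [smul_add, smul_smul, smul_smul]), ?_⟩
  rw [smul_smul, mul_inv_cancel₀ hs.ne', one_smul]

/-- A line-closed subset of the hyperboloid is a linear section of it. -/
lemma IsLineClosed.exists_submodule {S : Set (V × ℝ)} (hne : S.Nonempty) (hS : S ⊆ sheet V)
    (hl : IsLineClosed S) :
    ∃ W : Submodule ℝ (V × ℝ), S = {u | u ∈ W ∧ u ∈ sheet V} := by
  obtain ⟨P, hP⟩ := hne
  -- The span of `S`: positive combinations collapse to positive multiples of a single point of `S`,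
  -- so every element is a difference of two such multiples.
  refine ⟨{ carrier := {w | ∃ α β : ℝ, 0 < α ∧ 0 < β ∧ ∃ X ∈ S, ∃ Y ∈ S, w = α • X - β • Y}
            add_mem' := ?_, zero_mem' := ?_, smul_mem' := ?_ }, ?_⟩
  · rintro _ _ ⟨α, β, hα, hβ, X, hX, Y, hY, rfl⟩ ⟨α', β', hα', hβ', X', hX', Y', hY', rfl⟩
    obtain ⟨c, hc, Z, hZ, e⟩ := hl.exists_add_eq hS hX hX' hα hα'
    obtain ⟨c', hc', Z', hZ', e'⟩ := hl.exists_add_eq hS hY hY' hβ hβ'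
    exact ⟨c, c', hc, hc', Z, hZ, Z', hZ', by rw [← e, ← e']; abel⟩
  · exact ⟨1, 1, one_pos, one_pos, P, hP, P, hP, by simp⟩
  · rintro c _ ⟨α, β, hα, hβ, X, hX, Y, hY, rfl⟩
    rcases lt_trichotomy c 0 with hc | rfl | hc
    · exact ⟨-c * β, -c * α, mul_pos (neg_pos.mpr hc) hβ, mul_pos (neg_pos.mpr hc) hα,
        Y, hY, X, hX, by module⟩
    · exact ⟨1, 1, one_pos, one_pos, P, hP, P, hP, by simp⟩
    · exact ⟨c * α, c * β, mul_pos hc hα, mul_pos hc hβ, X, hX, Y, hY, by module⟩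
  · ext u
    constructor
    · intro hu
      exact ⟨⟨2, 1, two_pos, one_pos, u, hu, u, hu, by module⟩, hS hu⟩
    · rintro ⟨⟨α, β, -, -, X, hX, Y, hY, e⟩, hu⟩
      exact hl X hX Y hY u hu α (-β) (by rw [e]; module)

/-- The Lorentz-orthogonal projection onto a subspace that contains a timelike vector. -/
lemma exists_lor_projection [FiniteDimensional ℝ V] (W : Submodule ℝ (V × ℝ)) {P : V × ℝ}
    (hP : P ∈ W) (hPP : 0 < lor P P) :
    ∃ T : (V × ℝ) →L[ℝ] (V × ℝ), (∀ u, T u ∈ W) ∧ (∀ u ∈ W, T u = u) ∧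
      ∀ u, ∀ w ∈ W, lor (u - T u) w = 0 := by
  have hnd : ((lor (V := V)).restrict W).Nondegenerate := by
    -- A vector in the radical is orthogonal both to the timelike `P` and to itself, hence zero.
    have key : ∀ w : W, (∀ y : W, lor (w : V × ℝ) y = 0) → w = 0 := fun w hw =>
      Subtype.ext <| eq_zero_of_lor_self hPP (by rw [lor_comm]; exact hw ⟨P, hP⟩) (hw w).ge
    exact ⟨fun w hw => key w hw, fun w hw => key w fun y => by rw [lor_comm]; exact hw y⟩
  have hc := LinearMap.BilinForm.isCompl_orthogonal_of_restrict_nondegenerate isRefl_lor hnd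
  refine ⟨LinearMap.toContinuousLinearMap (W.projection _ hc), fun u => ?_,
    fun u hu => ?_, fun u w hw => ?_⟩
  · exact Submodule.projection_apply_mem hc u
  · exact Submodule.projection_apply_of_mem_left hc hu
  · rw [lor_comm]
    exact Submodule.sub_projection_mem hc u w hw

end Lorentz

end Hyp

namespace Hyp

/-! ### The closest-point projection on the hyperboloid and its derivative. -/

section Projection

variable {V : Type*} [NormedAddCommGroup V] [InnerProductSpace ℝ V]

/-- `T` is a Lorentz-orthogonal projection whose range contains the point `P` of the
hyperboloid. -/
structure IsLorProj (T : (V × ℝ) →L[ℝ] (V × ℝ)) (P : V × ℝ) : Prop where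
  idem : ∀ u, T (T u) = T u
  orth : ∀ u v, lor (u - T u) (T v) = 0
  base : T P = P
  mem : P ∈ sheet V

/-- The radial projection of `T u` to the hyperboloid. -/
noncomputable def foot (T : (V × ℝ) →L[ℝ] (V × ℝ)) (u : V × ℝ) : V × ℝ :=
  (√(lor (T u) (T u)))⁻¹ • T u

/-- The velocity of `foot T` at `u` in the direction `v`. -/
noncomputable def footDeriv (T : (V × ℝ) →L[ℝ] (V × ℝ)) (u v : V × ℝ) : V × ℝ :=
  (√(lor (T u) (T u)))⁻¹ • T v -
    (lor (T u) (T v) / (√(lor (T u) (T u)) * lor (T u) (T u))) • T u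

namespace IsLorProj

variable {T : (V × ℝ) →L[ℝ] (V × ℝ)} {P : V × ℝ}

lemma base_pos (h : IsLorProj T P) : 0 < lor P P := by rw [h.mem.1]; exact one_pos

lemma lor_base_sub (h : IsLorProj T P) (u : V × ℝ) : lor P (u - T u) = 0 := by
  rw [lor_comm]
  simpa only [h.base] using h.orth u P

lemma lor_left (h : IsLorProj T P) (u v : V × ℝ) : lor u (T v) = lor (T u) (T v) := by
  have := h.orth u v
  rw [map_sub, LinearMap.sub_apply] at this
  linarith

lemma lor_eq_add (h : IsLorProj T P) (u v : V × ℝ) :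
    lor u v = lor (T u) (T v) + lor (u - T u) (v - T v) := by
  have h1 := h.lor_left u v
  have h2 := h.lor_left v u
  rw [lor_comm v, lor_comm (T v)] at h2
  simp only [map_sub, LinearMap.sub_apply]
  linarith

/-- The discarded component `u - T u` is orthogonal to a timelike vector, so its square is
nonpositive. -/
lemma le_lor (h : IsLorProj T P) (u : V × ℝ) : lor u u ≤ lor (T u) (T u) := by
  have := lor_self_nonpos h.base_pos (h.lor_base_sub u)
  linarith [h.lor_eq_add u u]

lemma one_le (h : IsLorProj T P) {u : V × ℝ} (hu : u ∈ sheet V) : 1 ≤ lor (T u) (T u) :=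
  hu.1 ▸ h.le_lor u

/-- The equality case of `one_le`; it is the source of strict contraction off `M`. -/
lemma apply_eq_self (h : IsLorProj T P) {u : V × ℝ} (hu : u ∈ sheet V)
    (h1 : lor (T u) (T u) ≤ 1) : T u = u := by
  have := eq_zero_of_lor_self h.base_pos (h.lor_base_sub u)
    (by linarith [h.lor_eq_add u u, hu.1])
  exact (sub_eq_zero.mp this).symm

lemma snd_pos (h : IsLorProj T P) {u : V × ℝ} (hu : u ∈ sheet V) : 0 < (T u).2 := by
  refine snd_pos_of_lor_pos h.base_pos h.mem.2 (one_pos.trans_le (h.one_le hu)) ?_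
  have h2 := h.lor_left u P
  rw [h.base] at h2
  rw [lor_comm, ← h2, lor_comm]
  exact one_pos.trans_le (one_le_lor h.mem hu)

lemma foot_mem (h : IsLorProj T P) {u : V × ℝ} (hu : u ∈ sheet V) : foot T u ∈ sheet V :=
  normalize_mem_sheet (one_pos.trans_le (h.one_le hu)) (h.snd_pos hu)

lemma apply_foot (h : IsLorProj T P) (u : V × ℝ) : T (foot T u) = foot T u := by
  rw [foot, map_smul, h.idem]

/-- For `z` on the hyperboloid this is the hyperbolic Pythagorean theorem for the right angle at
`foot T u`: the hyperbolic cosines of the legs multiply. -/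
lemma lor_eq_mul (h : IsLorProj T P) {u z : V × ℝ} (hu : u ∈ sheet V) (hz : T z = z) :
    lor u z = √(lor (T u) (T u)) * lor (foot T u) z := by
  have h2 := h.lor_left u z
  have h3 := Real.sqrt_pos.mpr (one_pos.trans_le (h.one_le hu))
  rw [hz] at h2
  rw [h2, foot, map_smul, LinearMap.smul_apply, smul_eq_mul, mul_inv_cancel_left₀ h3.ne']

lemma lor_foot (h : IsLorProj T P) {u : V × ℝ} (hu : u ∈ sheet V) :
    lor u (foot T u) = √(lor (T u) (T u)) := by
  rw [h.lor_eq_mul hu (h.apply_foot u), (h.foot_mem hu).1, mul_one]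

/-- The infinitesimal contraction of the closest-point projection. -/
lemma footDeriv_le (h : IsLorProj T P) {u v : V × ℝ} (hu : u ∈ sheet V) (huv : lor u v = 0) :
    -lor (footDeriv T u v) (footDeriv T u v) ≤ (lor (T u) (T u))⁻¹ * -lor v v := by
  have h1 := h.one_le hu
  have hN := h.lor_eq_add u u
  have hN' := h.lor_eq_add v v
  have hNN := h.lor_eq_add u v
  have hcs := lor_sq_le h.base_pos (h.lor_base_sub u) (h.lor_base_sub v)
  have hn := lor_self_nonpos h.base_pos (h.lor_base_sub v)
  rw [hu.1] at hN
  rw [huv] at hNN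
  set q := lor (T u) (T u) with hq
  set k := lor (T u) (T v) with hk
  have hs := Real.sq_sqrt (zero_le_one.trans h1)
  have hsp := Real.sqrt_pos.mpr (one_pos.trans_le h1)
  have e : lor (footDeriv T u v) (footDeriv T u v) = q⁻¹ * (lor (T v) (T v) - k ^ 2 / q) := by
    simp only [footDeriv, map_sub, map_smul, LinearMap.sub_apply, LinearMap.smul_apply,
      smul_eq_mul, lor_comm (T v) (T u)]
    rw [← hq, ← hk]
    have h0 : q ≠ 0 := by positivity
    set c := √q
    rw [← hs] at h0 ⊢
    field_simp
    ring
  rw [e, ← mul_neg]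
  have hq0 : 0 < q := by positivity
  refine mul_le_mul_of_nonneg_left ?_ (inv_nonneg.mpr hq0.le)
  -- Since `lor u v = 0`, `k` is minus the product of the normal components. Cauchy-Schwarz gives `k
  -- ^ 2` at most `q - 1` times the right-hand side.
  have hk2 : k ^ 2 / q ≤ -lor (v - T v) (v - T v) := by
    rw [div_le_iff₀ hq0]
    have : k = -lor (u - T u) (v - T v) := by linarith
    rw [this]
    nlinarith
  linarith

end IsLorProj

lemma _root_.HasDerivWithinAt.lor {f g : ℝ → V × ℝ} {f' g' : V × ℝ} {s : Set ℝ} {t : ℝ}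
    (hf : HasDerivWithinAt f f' s t) (hg : HasDerivWithinAt g g' s t) :
    HasDerivWithinAt (fun t => lor (f t) (g t)) (lor (f t) g' + lor f' (g t)) s t := by
  have h1 {f : ℝ → V × ℝ} {f' : V × ℝ} (hf : HasDerivWithinAt f f' s t) :
      HasDerivWithinAt (fun t => (f t).1) f'.1 s t :=
    (ContinuousLinearMap.fst ℝ V ℝ).hasFDerivAt.comp_hasDerivWithinAt t hf
  have h2 {f : ℝ → V × ℝ} {f' : V × ℝ} (hf : HasDerivWithinAt f f' s t) :
      HasDerivWithinAt (fun t => (f t).2) f'.2 s t :=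
    (ContinuousLinearMap.snd ℝ V ℝ).hasFDerivAt.comp_hasDerivWithinAt t hf
  have := ((h2 hf).mul (h2 hg)).sub ((h1 hf).inner ℝ (h1 hg))
  simp only [lor_apply]
  convert! this using 1
  ring

lemma _root_.ContDiffOn.lor {f g : ℝ → V × ℝ} {s : Set ℝ} {n : WithTop ℕ∞}
    (hf : ContDiffOn ℝ n f s) (hg : ContDiffOn ℝ n g s) :
    ContDiffOn ℝ n (fun t => Hyp.lor (f t) (g t)) s := by
  simp only [lor_apply]
  exact (hf.snd.mul hg.snd).sub (hf.fst.inner ℝ hg.fst)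

lemma IsLorProj.hasDerivWithinAt_foot {T : (V × ℝ) →L[ℝ] (V × ℝ)} {P : V × ℝ}
    (h : IsLorProj T P) {Γ : ℝ → V × ℝ} {v : V × ℝ} {s : Set ℝ} {t : ℝ}
    (hΓ : HasDerivWithinAt Γ v s t) (hm : Γ t ∈ sheet V) :
    HasDerivWithinAt (fun t => foot T (Γ t)) (footDeriv T (Γ t) v) s t := by
  have hT : HasDerivWithinAt (fun t => T (Γ t)) (T v) s t :=
    T.hasFDerivAt.comp_hasDerivWithinAt t hΓ
  have hq : 0 < Hyp.lor (T (Γ t)) (T (Γ t)) := one_pos.trans_le (h.one_le hm)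
  have hs := Real.sq_sqrt hq.le
  have hsp := Real.sqrt_pos.mpr hq
  have := (((hT.lor hT).sqrt hq.ne').inv hsp.ne').smul hT
  refine this.congr_deriv ?_
  rw [footDeriv, sub_eq_add_neg, ← neg_smul, lor_comm (T v) (T (Γ t))]
  congr 2
  rw [hs]
  field_simp
  ring

lemma IsLorProj.contDiffOn_foot {T : (V × ℝ) →L[ℝ] (V × ℝ)} {P : V × ℝ}
    (h : IsLorProj T P) {Γ : ℝ → V × ℝ} {s : Set ℝ} {n : WithTop ℕ∞}
    (hΓ : ContDiffOn ℝ n Γ s) (hm : ∀ t ∈ s, Γ t ∈ sheet V) :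
    ContDiffOn ℝ n (fun t => foot T (Γ t)) s := by
  have hT : ContDiffOn ℝ n (fun t => T (Γ t)) s := T.contDiff.comp_contDiffOn hΓ
  have hq : ∀ t ∈ s, 0 < Hyp.lor (T (Γ t)) (T (Γ t)) := fun t ht =>
    one_pos.trans_le (h.one_le (hm t ht))
  exact (((hT.lor hT).sqrt fun t ht => (hq t ht).ne').inv
    fun t ht => (Real.sqrt_pos.mpr (hq t ht)).ne').smul hT

end Projection

end Hyp

namespace Hyp

/-! ### Stereographic projection between the Poincaré ball and the hyperboloid. -/

section Chart

variable {V : Type*} [NormedAddCommGroup V] [InnerProductSpace ℝ V]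

/-- The conformal factor of the Poincaré ball. -/
noncomputable def factor {V : Type*} [NormedAddCommGroup V] (x : V) : ℝ := 2 / (1 - ‖x‖ ^ 2)

/-- The isometry from the Poincaré ball to the hyperboloid. -/
noncomputable def toHyp (x : V) : V × ℝ := (factor x • x, factor x - 1)

/-- The stereographic projection from the hyperboloid to the Poincaré ball. -/
noncomputable def ofHyp (u : V × ℝ) : V := (1 + u.2)⁻¹ • u.1

lemma one_sub_sq_pos {V : Type*} [NormedAddCommGroup V] {x : V} (hx : ‖x‖ < 1) : 0 < 1 - ‖x‖ ^ 2 := by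
  nlinarith [norm_nonneg x]

lemma factor_pos {V : Type*} [NormedAddCommGroup V] {x : V} (hx : ‖x‖ < 1) : 0 < factor x := div_pos two_pos (one_sub_sq_pos hx)

lemma lor_toHyp {x y : V} (hx : ‖x‖ < 1) (hy : ‖y‖ < 1) : lor (toHyp x) (toHyp y) =
    1 + 2 * (‖x - y‖ ^ 2 / ((1 - ‖x‖ ^ 2) * (1 - ‖y‖ ^ 2))) := by
  have h1 := one_sub_sq_pos hx
  have h2 := one_sub_sq_pos hy
  simp only [lor_apply, toHyp, factor, real_inner_smul_left, real_inner_smul_right,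
    norm_sub_sq_real]
  field_simp
  ring

lemma toHyp_mem {x : V} (hx : ‖x‖ < 1) : toHyp x ∈ sheet V := by
  refine ⟨by rw [lor_toHyp hx hx]; simp, ?_⟩
  have h1 := one_sub_sq_pos hx
  have : toHyp x = (factor x • x, (1 + ‖x‖ ^ 2) / (1 - ‖x‖ ^ 2)) := by
    simp only [toHyp, factor]
    congr 1
    field_simp
    ring
  rw [this]
  positivity

lemma ofHyp_toHyp {x : V} (hx : ‖x‖ < 1) : ofHyp (toHyp x) = x := by
  have h1 := (factor_pos hx).ne'
  simp only [ofHyp, toHyp, smul_smul, add_sub_cancel, inv_mul_cancel₀ h1, one_smul]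

lemma norm_sq_ofHyp {u : V × ℝ} (hu : u ∈ sheet V) :
    ‖ofHyp u‖ ^ 2 = 1 - 2 / (1 + u.2) := by
  have h := hu.1
  have h2 := hu.2
  rw [lor_self] at h
  rw [ofHyp, norm_smul, mul_pow, Real.norm_eq_abs, sq_abs,
    (by linarith : ‖u.1‖ ^ 2 = (u.2 - 1) * (1 + u.2))]
  field_simp
  ring

lemma norm_ofHyp_lt {u : V × ℝ} (hu : u ∈ sheet V) : ‖ofHyp u‖ < 1 := by
  have h2 := hu.2
  have : 0 < 2 / (1 + u.2) := by positivity
  nlinarith [norm_sq_ofHyp hu, norm_nonneg (ofHyp u)]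

lemma toHyp_ofHyp {u : V × ℝ} (hu : u ∈ sheet V) : toHyp (ofHyp u) = u := by
  have h2 := hu.2
  have h3 : factor (ofHyp u) = 1 + u.2 := by
    rw [factor, norm_sq_ofHyp hu]
    field_simp
    ring
  rw [toHyp, h3, ofHyp, smul_smul, mul_inv_cancel₀ (by positivity), one_smul, add_sub_cancel_left]

lemma contDiffOn_toHyp {γ : ℝ → V} {s : Set ℝ} {n : WithTop ℕ∞} (hγ : ContDiffOn ℝ n γ s)
    (hb : ∀ t ∈ s, ‖γ t‖ < 1) : ContDiffOn ℝ n (fun t => toHyp (γ t)) s := by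
  have hf : ContDiffOn ℝ n (fun t => factor (γ t)) s :=
    contDiffOn_const.div (contDiffOn_const.sub (hγ.norm_sq ℝ))
      fun t ht => (one_sub_sq_pos (hb t ht)).ne'
  exact (hf.smul hγ).prodMk (hf.sub contDiffOn_const)

lemma contDiffOn_ofHyp {Γ : ℝ → V × ℝ} {s : Set ℝ} {n : WithTop ℕ∞} (hΓ : ContDiffOn ℝ n Γ s)
    (hm : ∀ t ∈ s, Γ t ∈ sheet V) : ContDiffOn ℝ n (fun t => ofHyp (Γ t)) s :=
  ((contDiffOn_const.add hΓ.snd).inv fun t ht => by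
    have := (hm t ht).2
    positivity).smul hΓ.fst

/-- The velocity of `toHyp` at `x` in the direction `v`. -/
noncomputable def toHypDeriv (x v : V) : V × ℝ :=
  ((factor x ^ 2 * inner ℝ x v) • x + factor x • v, factor x ^ 2 * inner ℝ x v)

lemma hasDerivWithinAt_toHyp {γ : ℝ → V} {v : V} {s : Set ℝ} {t : ℝ}
    (hγ : HasDerivWithinAt γ v s t) (hb : ‖γ t‖ < 1) :
    HasDerivWithinAt (fun t => toHyp (γ t)) (toHypDeriv (γ t) v) s t := by
  have h1 := one_sub_sq_pos hb
  have hf : HasDerivWithinAt (fun t => factor (γ t)) (factor (γ t) ^ 2 * inner ℝ (γ t) v) s t := by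
    refine ((hasDerivWithinAt_const t s (2 : ℝ)).div
      ((hasDerivWithinAt_const t s (1 : ℝ)).sub hγ.norm_sq) h1.ne').congr_deriv ?_
    simp only [factor, Pi.sub_apply]
    field_simp
    ring
  refine ((hf.smul hγ).prodMk (hf.sub_const 1)).congr_deriv ?_
  rw [toHypDeriv, add_comm]

/-- `toHyp` is a Riemannian isometry, so speeds can be compared on the hyperboloid. -/
lemma lor_toHypDeriv {x : V} (hx : ‖x‖ < 1) (v : V) :
    -lor (toHypDeriv x v) (toHypDeriv x v) = (factor x * ‖v‖) ^ 2 := by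
  have h1 := one_sub_sq_pos hx
  simp only [lor_apply, toHypDeriv, factor, inner_add_left, inner_add_right, real_inner_smul_left,
    real_inner_smul_right, real_inner_comm x v]
  rw [real_inner_self_eq_norm_sq, real_inner_self_eq_norm_sq]
  field_simp
  ring

lemma lor_toHyp_toHypDeriv {x : V} (hx : ‖x‖ < 1) (v : V) :
    lor (toHyp x) (toHypDeriv x v) = 0 := by
  have h1 := one_sub_sq_pos hx
  simp only [lor_apply, toHyp, toHypDeriv, factor, inner_add_right,
    real_inner_smul_left, real_inner_smul_right, real_inner_self_eq_norm_sq]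
  field_simp
  ring

end Chart

/-! ### Geodesics of the ball seen on the hyperboloid. -/

section Ball

variable {d : ℕ}

lemma mem_ball_iff {x : EuclideanSpace ℝ (Fin d)} : x ∈ ball d ↔ ‖x‖ < 1 := by
  rw [ball, mem_ball_zero_iff]

lemma hdist_eq {x y : EuclideanSpace ℝ (Fin d)} (hx : x ∈ ball d) (hy : y ∈ ball d) :
    hdist x y = Real.arcosh (lor (toHyp x) (toHyp y)) := by
  rw [hdist, lor_toHyp (mem_ball_iff.mp hx) (mem_ball_iff.mp hy)]

lemma cosh_hdist {x y : EuclideanSpace ℝ (Fin d)} (hx : x ∈ ball d) (hy : y ∈ ball d) :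
    Real.cosh (hdist x y) = lor (toHyp x) (toHyp y) := by
  rw [hdist_eq hx hy, Real.cosh_arcosh
    (one_le_lor (toHyp_mem (mem_ball_iff.mp hx)) (toHyp_mem (mem_ball_iff.mp hy)))]

lemma tangentNorm_eq (x v : EuclideanSpace ℝ (Fin d)) : tangentNorm x v = factor x * ‖v‖ := by
  rw [tangentNorm, factor]; ring

lemma hdist_ofHyp {u v : EuclideanSpace ℝ (Fin d) × ℝ} (hu : u ∈ sheet _) (hv : v ∈ sheet _) {r : ℝ}
    (h : lor u v = Real.cosh r) : hdist (ofHyp u) (ofHyp v) = |r| := by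
  rw [hdist_eq (mem_ball_iff.mpr (norm_ofHyp_lt hu)) (mem_ball_iff.mpr (norm_ofHyp_lt hv)),
    toHyp_ofHyp hu, toHyp_ofHyp hv, h, ← Real.cosh_abs, Real.arcosh_cosh (abs_nonneg r)]

lemma toHyp_injOn {x y : EuclideanSpace ℝ (Fin d)} (hx : x ∈ ball d) (hy : y ∈ ball d)
    (h : toHyp x = toHyp y) : x = y := by
  rw [← ofHyp_toHyp (mem_ball_iff.mp hx), h, ofHyp_toHyp (mem_ball_iff.mp hy)]

/-- The image of a totally geodesic set in the hyperboloid is line-closed. -/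
lemma IsTotallyGeodesic.isLineClosed {M : Set (EuclideanSpace ℝ (Fin d))}
    (hM : IsTotallyGeodesic M) : IsLineClosed (toHyp '' M) := by
  rintro _ ⟨p, hp, rfl⟩ _ ⟨q, hq, rfl⟩ Z hZ α β hZe
  have hpX := toHyp_mem (mem_ball_iff.mp (hM.2.1 hp))
  have hqY := toHyp_mem (mem_ball_iff.mp (hM.2.1 hq))
  set X := toHyp p with hX
  set Y := toHyp q with hY
  have hX1 := hpX.1
  have hXpos : 0 < lor X X := by rw [hX1]; exact one_pos
  have hZX := one_le_lor hpX hZ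
  -- If the points coincide there is no line through them; then `Z` is a multiple of `X`, and
  -- normalization forces `Z = X`.
  by_cases hXY : X = Y
  · have hz : Z = (α + β) • X := by rw [hZe, ← hXY, add_smul]
    have h1 := hZ.1
    rw [hz] at hZX h1
    simp only [map_smul, LinearMap.smul_apply, smul_eq_mul, hX1, mul_one] at hZX h1
    have : α + β = 1 := by nlinarith
    exact ⟨p, hp, by rw [hz, this, one_smul]⟩
  have hk : 1 < lor X Y := by
    by_contra! hc
    exact hXY (eq_of_lor_le_one hpX hqY hc)
  set k := lor X Y with hkdef
  have hk1 : 0 < k ^ 2 - 1 := by nlinarith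
  set m := √(k ^ 2 - 1) with hm
  have hmp : 0 < m := Real.sqrt_pos.mpr hk1
  have hm2 : m ^ 2 = k ^ 2 - 1 := Real.sq_sqrt hk1.le
  -- The unit tangent at `X` towards `Y`; `k` and `m` are the hyperbolic cosine and sine of the
  -- distance between them.
  set U := m⁻¹ • (Y - k • X) with hU
  have hXU : lor X U = 0 := by simp [hU, hX1, ← hkdef]
  have hUU : lor U U = -1 := by
    simp only [hU, map_sub, map_smul, LinearMap.sub_apply, LinearMap.smul_apply, smul_eq_mul,
      lor_comm Y X, hX1, hqY.1, ← hkdef]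
    field_simp
    linarith
  have hYU : Y = k • X + m • U := by
    rw [hU, smul_smul, mul_inv_cancel₀ hmp.ne', one_smul]; abel
  let Γ : ℝ → EuclideanSpace ℝ (Fin d) × ℝ := fun t => Real.cosh t • X + Real.sinh t • U
  have hΓΓ : ∀ s t, lor (Γ s) (Γ t) = Real.cosh (s - t) := by
    intro s t
    simp only [Γ, map_add, map_smul, LinearMap.add_apply, LinearMap.smul_apply, smul_eq_mul,
      lor_comm U X, hX1, hXU, hUU, Real.cosh_sub]
    ring
  have hΓX : ∀ t, lor X (Γ t) = Real.cosh t := by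
    intro t
    simp [Γ, hX1, hXU]
  have hΓ1 : ∀ t, lor (Γ t) (Γ t) = 1 := fun t => by rw [hΓΓ, sub_self, Real.cosh_zero]
  have hΓm : ∀ t, Γ t ∈ sheet _ := fun t => ⟨hΓ1 t,
    snd_pos_of_lor_pos hXpos hpX.2 (by rw [hΓ1]; exact one_pos)
      (by rw [hΓX]; exact Real.cosh_pos t)⟩
  have hgeo : IsGeodesicLine (fun t => ofHyp (Γ t)) :=
    ⟨fun t => mem_ball_iff.mpr (norm_ofHyp_lt (hΓm t)),
      fun s t => hdist_ofHyp (hΓm s) (hΓm t) (hΓΓ s t)⟩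
  -- The geodesic sweeps out the whole branch of the hyperbola in the plane of `X` and `U`, so it
  -- passes through `Y` and `Z`.
  have hpar : ∀ a b : ℝ, 0 < a → a ^ 2 - b ^ 2 = 1 → Γ (Real.arsinh b) = a • X + b • U := by
    intro a b ha hab
    have : √(1 + b ^ 2) = a := by rw [← hab, sub_add_cancel, Real.sqrt_sq ha.le]
    simp only [Γ, Real.cosh_arsinh, Real.sinh_arsinh, this]
  have h0 : ofHyp (Γ 0) ∈ M := by
    simpa [Γ, hX, ofHyp_toHyp (mem_ball_iff.mp (hM.2.1 hp))] using hp
  have h1 : ofHyp (Γ (Real.arsinh m)) ∈ M := by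
    rw [hpar k m (by linarith) (by linarith), ← hYU, hY, ofHyp_toHyp (mem_ball_iff.mp (hM.2.1 hq))]
    exact hq
  have hne : (0 : ℝ) ≠ Real.arsinh m := fun h => hmp.ne' (Real.arsinh_eq_zero_iff.mp h.symm)
  have hZU : Z = (α + β * k) • X + (β * m) • U := by rw [hZe, hYU]; module
  have hZ1 := hZ.1
  rw [hZU, sq_sum_lor, hX1, hXU, hUU] at hZ1
  rw [hZU] at hZX
  simp only [map_add, map_smul, smul_eq_mul, hX1, hXU, mul_one, mul_zero, add_zero] at hZX
  refine ⟨_, hM.2.2 _ hgeo 0 _ hne h0 h1 (Real.arsinh (β * m)), ?_⟩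
  rw [toHyp_ofHyp (hΓm _), hpar (α + β * k) (β * m) (by linarith) (by linarith), hZU]

/-- Geodesic segments are smooth. -/
lemma IsGeodesicSegment.isSmoothPath {γ : ℝ → EuclideanSpace ℝ (Fin d)} {a b : ℝ} (hab : a ≤ b)
    (h : IsGeodesicSegment γ a b) : IsSmoothPath γ a b := by
  refine ⟨h.1, ?_⟩
  rcases hab.eq_or_lt with rfl | hab
  · rw [Set.Icc_self]
    intro t ht
    rw [Set.mem_singleton_iff.mp ht]
    exact contDiffWithinAt_singleton
  have ha : a ∈ Set.Icc a b := Set.left_mem_Icc.mpr hab.le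
  have hb : b ∈ Set.Icc a b := Set.right_mem_Icc.mpr hab.le
  have hm : ∀ t ∈ Set.Icc a b, toHyp (γ t) ∈ sheet _ := fun t ht =>
    toHyp_mem (mem_ball_iff.mp (h.1 t ht))
  have hl : ∀ s ∈ Set.Icc a b, ∀ t ∈ Set.Icc a b,
      lor (toHyp (γ s)) (toHyp (γ t)) = Real.cosh (s - t) := fun s hs t ht => by
    rw [← cosh_hdist (h.1 s hs) (h.1 t ht), h.2 s hs t ht, Real.cosh_abs]
  have hL : 0 < Real.sinh (b - a) := Real.sinh_pos_iff.mpr (sub_pos.mpr hab)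
  -- The explicit geodesic between the endpoints, with weights that are visibly smooth in `t`.
  let R : ℝ → EuclideanSpace ℝ (Fin d) × ℝ := fun t =>
    (Real.sinh (b - t) / Real.sinh (b - a)) • toHyp (γ a) +
      (Real.sinh (t - a) / Real.sinh (b - a)) • toHyp (γ b)
  have hR : ∀ t ∈ Set.Icc a b, toHyp (γ t) = R t := by
    intro t ht
    -- Together with `e2`, this makes `toHyp (γ t) - R t` orthogonal to the timelike `toHyp (γ t)`
    -- and of zero Lorentz square, hence zero. Membership of `R t` in the sheet is not needed
    -- beforehand.
    have e1 : lor (toHyp (γ t)) (R t) = 1 := by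
      simp only [R, map_add, map_smul, smul_eq_mul, hl t ht a ha, hl t ht b hb]
      rw [← Real.cosh_neg (t - b), neg_sub]
      field_simp
      rw [mul_comm (Real.sinh (t - a)), ← Real.sinh_add]
      congr 1
      ring
    have e2 : lor (R t) (R t) = 1 := by
      simp only [R]
      rw [sq_sum_lor, hl a ha a ha, hl a ha b hb, hl b hb b hb, sub_self, sub_self, Real.cosh_zero,
        ← Real.cosh_neg (a - b), neg_sub]
      have e : b - a = (b - t) + (t - a) := by ring
      field_simp
      rw [e, Real.sinh_add, Real.cosh_add]
      have h1 := Real.cosh_sq (b - t)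
      have h2 := Real.cosh_sq (t - a)
      generalize Real.cosh (b - t) = c at *
      generalize Real.cosh (t - a) = c' at *
      generalize Real.sinh (b - t) = s at *
      generalize Real.sinh (t - a) = s' at *
      linear_combination (-s' ^ 2) * h1 - s ^ 2 * h2
    have := eq_zero_of_lor_self (X := toHyp (γ t)) (u := toHyp (γ t) - R t)
      (by rw [(hm t ht).1]; exact one_pos) (by rw [map_sub, (hm t ht).1, e1, sub_self])
      (by simp [(hm t ht).1, e1, e2, lor_comm (R t)])
    exact sub_eq_zero.mp this
  have hRs : ContDiff ℝ ∞ R :=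
    (((Real.contDiff_sinh.comp (contDiff_const.sub contDiff_id)).div_const _).smul
      contDiff_const).add
    (((Real.contDiff_sinh.comp (contDiff_id.sub contDiff_const)).div_const _).smul contDiff_const)
  refine (contDiffOn_ofHyp hRs.contDiffOn fun t ht => hR t ht ▸ hm t ht).congr fun t ht => ?_
  rw [← hR t ht, ofHyp_toHyp (mem_ball_iff.mp (h.1 t ht))]

end Ball

end Hyp

namespace Hyp

/-! ### The projection in the ball: closest points, speeds and stationary paths. -/

variable {d : ℕ} {M : Set (EuclideanSpace ℝ (Fin d))}

/-- A totally geodesic set is the part of the hyperboloid fixed by a Lorentz-orthogonal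
projection. -/
lemma IsTotallyGeodesic.exists_isLorProj (hM : IsTotallyGeodesic M) :
    ∃ (T : (EuclideanSpace ℝ (Fin d) × ℝ) →L[ℝ] (EuclideanSpace ℝ (Fin d) × ℝ))
      (P : EuclideanSpace ℝ (Fin d) × ℝ), IsLorProj T P ∧
        ∀ x ∈ ball d, x ∈ M ↔ T (toHyp x) = toHyp x := by
  have hS : toHyp '' M ⊆ sheet _ := by
    rintro _ ⟨x, hx, rfl⟩
    exact toHyp_mem (mem_ball_iff.mp (hM.2.1 hx))
  obtain ⟨W, hW⟩ := hM.isLineClosed.exists_submodule (hM.1.image _) hS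
  obtain ⟨p, hp⟩ := hM.1
  have hpW : toHyp p ∈ W ∧ toHyp p ∈ sheet _ := by
    have := Set.mem_image_of_mem toHyp hp
    rwa [hW] at this
  obtain ⟨T, hT1, hT2, hT3⟩ :=
    exists_lor_projection W hpW.1 (by rw [hpW.2.1]; exact one_pos)
  refine ⟨T, toHyp p, ⟨fun u => hT2 _ (hT1 u), fun u v => hT3 u _ (hT1 v), hT2 _ hpW.1, hpW.2⟩,
    fun x hx => ⟨fun h => ?_, fun h => ?_⟩⟩
  · have := Set.mem_image_of_mem toHyp h
    rw [hW] at this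
    exact hT2 _ this.1
  · have : toHyp x ∈ toHyp '' M := by
      rw [hW]
      exact ⟨h ▸ hT1 _, toHyp_mem (mem_ball_iff.mp hx)⟩
    obtain ⟨y, hy, e⟩ := this
    rwa [← toHyp_injOn (hM.2.1 hy) hx e]

section

variable {T : (EuclideanSpace ℝ (Fin d) × ℝ) →L[ℝ] (EuclideanSpace ℝ (Fin d) × ℝ)}
  {P : EuclideanSpace ℝ (Fin d) × ℝ}

/-- By `lor_eq_mul`, passing from the foot to another `z` in `M` multiplies the hyperbolic cosine of
the distance by `lor (foot T (toHyp x)) (toHyp z)`, which is at least `1`, with equality only at the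
foot. -/
lemma isClosestPoint_foot (hT : IsLorProj T P) (hMb : M ⊆ ball d)
    (hMT : ∀ x ∈ ball d, x ∈ M ↔ T (toHyp x) = toHyp x) {x : EuclideanSpace ℝ (Fin d)}
    (hx : x ∈ ball d) :
    IsClosestPoint M x (ofHyp (foot T (toHyp x))) ∧
      ∀ y, IsClosestPoint M x y → y = ofHyp (foot T (toHyp x)) := by
  have hX := toHyp_mem (mem_ball_iff.mp hx)
  have hF := hT.foot_mem hX
  have hc := Real.sqrt_pos.mpr (one_pos.trans_le (hT.one_le hX))
  have hfb : ofHyp (foot T (toHyp x)) ∈ ball d := mem_ball_iff.mpr (norm_ofHyp_lt hF)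
  have hfM : ofHyp (foot T (toHyp x)) ∈ M := by
    rw [hMT _ hfb, toHyp_ofHyp hF, hT.apply_foot]
  have hle : ∀ z ∈ M, hdist x (ofHyp (foot T (toHyp x))) ≤ hdist x z ∧
      (hdist x z ≤ hdist x (ofHyp (foot T (toHyp x))) → z = ofHyp (foot T (toHyp x))) := by
    intro z hz
    have hZ := toHyp_mem (mem_ball_iff.mp (hMb hz))
    have h1 := one_le_lor hF hZ
    have e := hT.lor_eq_mul hX ((hMT z (hMb hz)).mp hz)
    rw [hdist_eq hx hfb, hdist_eq hx (hMb hz), toHyp_ofHyp hF, hT.lor_foot hX, e,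
      Real.arcosh_le_arcosh hc (by positivity), Real.arcosh_le_arcosh (by positivity) hc]
    refine ⟨le_mul_of_one_le_right hc.le h1, fun h => ?_⟩
    have h2 : lor (foot T (toHyp x)) (toHyp z) ≤ 1 := by
      rwa [mul_le_iff_le_one_right hc] at h
    rw [eq_of_lor_le_one hF hZ h2, ofHyp_toHyp (mem_ball_iff.mp (hMb hz))]
  exact ⟨⟨hfM, fun z hz => (hle z hz).1⟩, fun y hy => (hle y hy.1).2 (hy.2 _ hfM)⟩

lemma proj_eq_foot (hT : IsLorProj T P) (hMb : M ⊆ ball d)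
    (hMT : ∀ x ∈ ball d, x ∈ M ↔ T (toHyp x) = toHyp x) {x : EuclideanSpace ℝ (Fin d)}
    (hx : x ∈ ball d) : proj M x = ofHyp (foot T (toHyp x)) := by
  have h := isClosestPoint_foot hT hMb hMT hx
  exact h.2 _ (Classical.epsilon_spec ⟨_, h.1⟩)

lemma cosh_le_of_le_distTo (hT : IsLorProj T P) (hMb : M ⊆ ball d)
    (hMT : ∀ x ∈ ball d, x ∈ M ↔ T (toHyp x) = toHyp x) {x : EuclideanSpace ℝ (Fin d)}
    (hx : x ∈ ball d) {r : ℝ} (hr : 0 ≤ r) (h : r ≤ distTo x M) :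
    Real.cosh r ≤ √(lor (T (toHyp x)) (T (toHyp x))) := by
  obtain ⟨⟨hf, hmin⟩, -⟩ := isClosestPoint_foot hT hMb hMT hx
  have hX := toHyp_mem (mem_ball_iff.mp hx)
  have hle : distTo x M ≤ hdist x (ofHyp (foot T (toHyp x))) :=
    csInf_le ⟨_, by rintro _ ⟨z, hz, rfl⟩; exact hmin z hz⟩ (Set.mem_image_of_mem _ hf)
  have := cosh_hdist hx (hMb hf)
  rw [toHyp_ofHyp (hT.foot_mem hX), hT.lor_foot hX] at this
  rw [← this]
  have h0 := h.trans hle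
  rwa [Real.cosh_le_cosh, abs_of_nonneg hr, abs_of_nonneg (hr.trans h0)]

lemma tangentNorm_nonneg {x : EuclideanSpace ℝ (Fin d)} (hx : x ∈ ball d)
    (v : EuclideanSpace ℝ (Fin d)) : 0 ≤ tangentNorm x v := by
  rw [tangentNorm_eq]
  exact mul_nonneg (factor_pos (mem_ball_iff.mp hx)).le (norm_nonneg _)

/-- The closest-point projection shrinks velocities by the factor `cosh` of the distance. -/
lemma tangentNorm_le_of_toHyp_eq_foot (hT : IsLorProj T P)
    {γ δ : ℝ → EuclideanSpace ℝ (Fin d)} {v w : EuclideanSpace ℝ (Fin d)} {s : Set ℝ} {t : ℝ}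
    (hs : UniqueDiffWithinAt ℝ s t) (ht : t ∈ s)
    (hγ : HasDerivWithinAt γ v s t) (hδ : HasDerivWithinAt δ w s t)
    (hγb : γ t ∈ ball d) (hδb : δ t ∈ ball d)
    (he : ∀ t ∈ s, toHyp (δ t) = foot T (toHyp (γ t))) :
    tangentNorm (δ t) w ≤
      (√(lor (T (toHyp (γ t))) (T (toHyp (γ t)))))⁻¹ * tangentNorm (γ t) v := by
  have hγb' := mem_ball_iff.mp hγb
  have hδb' := mem_ball_iff.mp hδb
  have hX := toHyp_mem hγb'
  have h1 := hasDerivWithinAt_toHyp hδ hδb'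
  have h2 := (hT.hasDerivWithinAt_foot (hasDerivWithinAt_toHyp hγ hγb') hX).congr he (he t ht)
  -- The two curves on the hyperboloid coincide on `s`, so their velocities agree.
  have e : toHypDeriv (δ t) w = footDeriv T (toHyp (γ t)) (toHypDeriv (γ t) v) := hs.eq_deriv _ h1 h2
  have h3 := hT.footDeriv_le hX (lor_toHyp_toHypDeriv hγb' v)
  rw [← e, lor_toHypDeriv hδb', lor_toHypDeriv hγb', ← tangentNorm_eq, ← tangentNorm_eq] at h3
  have h4 := tangentNorm_nonneg hγb v
  refine le_of_sq_le_sq ?_ (by positivity)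
  rwa [mul_pow, inv_pow, Real.sq_sqrt (zero_le_one.trans (hT.one_le hX))]

end

lemma IsSmoothPath.hasDerivWithinAt {γ : ℝ → EuclideanSpace ℝ (Fin d)} {a b : ℝ}
    (h : IsSmoothPath γ a b) {t : ℝ} (ht : t ∈ Set.Icc a b) :
    HasDerivWithinAt γ (derivWithin γ (Set.Icc a b) t) (Set.Icc a b) t :=
  (h.2.differentiableOn (by simp) t ht).hasDerivWithinAt

lemma IsSmoothPath.continuousOn_tangentNorm {γ : ℝ → EuclideanSpace ℝ (Fin d)} {a b : ℝ}
    (hab : a < b) (h : IsSmoothPath γ a b) :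
    ContinuousOn (fun t => tangentNorm (γ t) (derivWithin γ (Set.Icc a b) t)) (Set.Icc a b) :=
  (continuousOn_const.mul
    (h.2.continuousOn_derivWithin (uniqueDiffOn_Icc hab) (by simp)).norm).div
    (continuousOn_const.sub (h.2.continuousOn.norm.pow 2))
    fun t ht => (one_sub_sq_pos (mem_ball_iff.mp (h.1 t ht))).ne'

lemma eq_zero_of_tangentNorm_nonpos {x v : EuclideanSpace ℝ (Fin d)} (hx : x ∈ ball d)
    (h : tangentNorm x v ≤ 0) : v = 0 := by
  rw [tangentNorm_eq] at h
  have := factor_pos (mem_ball_iff.mp hx)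
  by_contra hv
  have : 0 < ‖v‖ := norm_pos_iff.mpr hv
  exact absurd h (not_le.mpr (by positivity))

/-- A smooth path that is stationary whenever it is off the fixed space of `T` is constant,
unless it stays in the fixed space. -/
lemma eq_left_of_stationary_off
    {T : (EuclideanSpace ℝ (Fin d) × ℝ) →L[ℝ] (EuclideanSpace ℝ (Fin d) × ℝ)}
    {P : EuclideanSpace ℝ (Fin d) × ℝ} (hT : IsLorProj T P)
    {γ : ℝ → EuclideanSpace ℝ (Fin d)} {a b : ℝ} (hγ : IsSmoothPath γ a b)
    (h0 : ∀ t ∈ Set.Icc a b, T (toHyp (γ t)) ≠ toHyp (γ t) →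
      derivWithin γ (Set.Icc a b) t = 0)
    (hoff : ∃ t ∈ Set.Icc a b, T (toHyp (γ t)) ≠ toHyp (γ t)) :
    ∀ t ∈ Set.Icc a b, γ t = γ a := by
  set N : ℝ → EuclideanSpace ℝ (Fin d) × ℝ := fun t => toHyp (γ t) - T (toHyp (γ t)) with hN
  have hNd : ∀ t ∈ Set.Icc a b, HasDerivWithinAt N
      (toHypDeriv (γ t) (derivWithin γ (Set.Icc a b) t) -
        T (toHypDeriv (γ t) (derivWithin γ (Set.Icc a b) t))) (Set.Icc a b) t := fun t ht => by
    have := hasDerivWithinAt_toHyp (hγ.hasDerivWithinAt ht) (mem_ball_iff.mp (hγ.1 t ht))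
    exact this.sub (T.hasFDerivAt.comp_hasDerivWithinAt t this)
  -- `-lor (N t) (N t)` is the squared hyperbolic sine of the distance to the fixed space. Its
  -- derivative vanishes on the fixed space because `N t = 0`, and off it because the path is
  -- stationary.
  have hNN : ∀ t ∈ Set.Icc a b,
      HasDerivWithinAt (fun t => lor (N t) (N t)) 0 (Set.Icc a b) t := by
    intro t ht
    refine ((hNd t ht).lor (hNd t ht)).congr_deriv ?_
    by_cases hz : T (toHyp (γ t)) = toHyp (γ t)
    · have : N t = 0 := by simp only [hN]; rw [hz, sub_self]
      simp [this]
    · have : toHypDeriv (γ t) 0 = 0 := by simp [toHypDeriv]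
      simp [h0 t ht hz, this]
  have hconst := constant_of_derivWithin_zero (fun t ht => (hNN t ht).differentiableWithinAt)
    fun t ht => (hNN t (Set.Ico_subset_Icc_self ht)).derivWithin
      (uniqueDiffOn_Icc (ht.1.trans_lt ht.2) t (Set.Ico_subset_Icc_self ht))
  obtain ⟨t₀, ht₀, hoff⟩ := hoff
  have hne : ∀ t ∈ Set.Icc a b, T (toHyp (γ t)) ≠ toHyp (γ t) := by
    intro t ht hz
    have hNt : N t = 0 := by simp only [hN]; rw [hz, sub_self]
    have h1 : lor (N t₀) (N t₀) = 0 := by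
      have := (hconst t₀ ht₀).trans (hconst t ht).symm
      simpa only [hNt, map_zero] using this
    have := eq_zero_of_lor_self hT.base_pos (hT.lor_base_sub (toHyp (γ t₀))) h1.ge
    exact hoff (sub_eq_zero.mp this).symm
  exact constant_of_derivWithin_zero (hγ.2.differentiableOn (by simp))
    fun t ht => h0 t (Set.Ico_subset_Icc_self ht) (hne t (Set.Ico_subset_Icc_self ht))

/-! ### Comparison of lengths. -/

section

variable {T : (EuclideanSpace ℝ (Fin d) × ℝ) →L[ℝ] (EuclideanSpace ℝ (Fin d) × ℝ)}
  {P : EuclideanSpace ℝ (Fin d) × ℝ} {γ : ℝ → EuclideanSpace ℝ (Fin d)} {a b : ℝ}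

lemma IsSmoothPath.toHyp_mem (hγ : IsSmoothPath γ a b) {t : ℝ} (ht : t ∈ Set.Icc a b) :
    toHyp (γ t) ∈ sheet _ :=
  Hyp.toHyp_mem (mem_ball_iff.mp (hγ.1 t ht))

lemma IsSmoothPath.proj (hγ : IsSmoothPath γ a b) (hT : IsLorProj T P) (hMb : M ⊆ ball d)
    (hMT : ∀ x ∈ ball d, x ∈ M ↔ T (toHyp x) = toHyp x) :
    IsSmoothPath (fun t => Hyp.proj M (γ t)) a b := by
  refine ⟨fun t ht => ?_, ?_⟩
  · beta_reduce
    rw [proj_eq_foot hT hMb hMT (hγ.1 t ht)]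
    exact mem_ball_iff.mpr (norm_ofHyp_lt (hT.foot_mem (hγ.toHyp_mem ht)))
  · have hX := contDiffOn_toHyp hγ.2 fun t ht => mem_ball_iff.mp (hγ.1 t ht)
    exact (contDiffOn_ofHyp (hT.contDiffOn_foot hX fun t ht => hγ.toHyp_mem ht)
      fun t ht => hT.foot_mem (hγ.toHyp_mem ht)).congr
      fun t ht => proj_eq_foot hT hMb hMT (hγ.1 t ht)

lemma IsSmoothPath.tangentNorm_proj_le (hγ : IsSmoothPath γ a b) (hab : a < b)
    (hT : IsLorProj T P) (hMb : M ⊆ ball d)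
    (hMT : ∀ x ∈ ball d, x ∈ M ↔ T (toHyp x) = toHyp x) {t : ℝ} (ht : t ∈ Set.Icc a b) :
    tangentNorm (Hyp.proj M (γ t))
        (derivWithin (fun t => Hyp.proj M (γ t)) (Set.Icc a b) t) ≤
      (√(lor (T (toHyp (γ t))) (T (toHyp (γ t)))))⁻¹ *
        tangentNorm (γ t) (derivWithin γ (Set.Icc a b) t) := by
  have hδ := hγ.proj hT hMb hMT
  have he : ∀ u ∈ Set.Icc a b, toHyp (Hyp.proj M (γ u)) = foot T (toHyp (γ u)) := fun u hu => by
    rw [proj_eq_foot hT hMb hMT (hγ.1 u hu), toHyp_ofHyp (hT.foot_mem (hγ.toHyp_mem hu))]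
  have hδ' := hδ.hasDerivWithinAt ht
  have hδb : Hyp.proj M (γ t) ∈ ball d := hδ.1 t ht
  exact tangentNorm_le_of_toHyp_eq_foot (δ := fun t => Hyp.proj M (γ t)) hT
    (uniqueDiffOn_Icc hab t ht) ht (hγ.hasDerivWithinAt ht) hδ' (hγ.1 t ht) hδb he

lemma IsSmoothPath.length_proj_le (hγ : IsSmoothPath γ a b) (hab : a ≤ b)
    (hT : IsLorProj T P) (hMb : M ⊆ ball d)
    (hMT : ∀ x ∈ ball d, x ∈ M ↔ T (toHyp x) = toHyp x) {r : ℝ} (hr : 0 ≤ r)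
    (hd : ∀ t ∈ Set.Icc a b, r ≤ distTo (γ t) M) :
    length (fun t => Hyp.proj M (γ t)) a b ≤ 1 / Real.cosh r * length γ a b := by
  rcases hab.eq_or_lt with rfl | hlt
  · simp [length]
  rw [length, length, ← intervalIntegral.integral_const_mul]
  refine intervalIntegral.integral_mono_on hab
    (((hγ.proj hT hMb hMT).continuousOn_tangentNorm hlt).intervalIntegrable_of_Icc hab)
    ((continuousOn_const.mul
      (hγ.continuousOn_tangentNorm hlt)).intervalIntegrable_of_Icc hab) fun t ht => ?_
  refine (hγ.tangentNorm_proj_le hlt hT hMb hMT ht).trans (mul_le_mul_of_nonneg_right ?_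
    (tangentNorm_nonneg (hγ.1 t ht) _))
  rw [one_div]
  exact inv_anti₀ (Real.cosh_pos r)
    (cosh_le_of_le_distTo hT hMb hMT (hγ.1 t ht) hr (hd t ht))

lemma IsSmoothPath.length_nonneg (hγ : IsSmoothPath γ a b) (hab : a ≤ b) : 0 ≤ length γ a b :=
  intervalIntegral.integral_nonneg hab fun t ht => tangentNorm_nonneg (hγ.1 t ht) _

lemma IsSmoothPath.length_proj_lt (hγ : IsSmoothPath γ a b) (hab : a < b)
    (hT : IsLorProj T P) (hMb : M ⊆ ball d)
    (hMT : ∀ x ∈ ball d, x ∈ M ↔ T (toHyp x) = toHyp x)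
    (hne : ∃ t ∈ Set.Icc a b, γ t ≠ γ a) (hoff : ∃ t ∈ Set.Icc a b, γ t ∉ M) :
    length (fun t => Hyp.proj M (γ t)) a b < length γ a b := by
  have hle : ∀ t ∈ Set.Icc a b, _ := fun t ht => hγ.tangentNorm_proj_le hab hT hMb hMT ht
  refine intervalIntegral.integral_lt_integral_of_continuousOn_of_le_of_exists_lt hab
    ((hγ.proj hT hMb hMT).continuousOn_tangentNorm hab) (hγ.continuousOn_tangentNorm hab)
    (fun t ht => ?_) ?_
  · have ht' := Set.Ioc_subset_Icc_self ht
    exact (hle t ht').trans (mul_le_of_le_one_left (tangentNorm_nonneg (hγ.1 t ht') _)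
      (inv_le_one_of_one_le₀ (Real.one_le_sqrt.mpr (hT.one_le (hγ.toHyp_mem ht')))))
  -- If the integrand is nowhere strictly smaller, then off `M`, where the contraction factor is
  -- below `1`, the speed must be zero.
  by_contra! hcon
  have hstat : ∀ t ∈ Set.Icc a b, T (toHyp (γ t)) ≠ toHyp (γ t) →
      derivWithin γ (Set.Icc a b) t = 0 := by
    intro t ht hTt
    refine eq_zero_of_tangentNorm_nonpos (hγ.1 t ht) (not_lt.mp fun hpos => ?_)
    have hc : 1 < √(lor (T (toHyp (γ t))) (T (toHyp (γ t)))) := by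
      rw [Real.lt_sqrt zero_le_one, one_pow]
      by_contra! h
      exact hTt (hT.apply_eq_self (hγ.toHyp_mem ht) h)
    exact absurd ((hcon t ht).trans (hle t ht))
      (not_le.mpr (mul_lt_of_lt_one_left hpos (inv_lt_one_of_one_lt₀ hc)))
  obtain ⟨t₀, ht₀, ht₀M⟩ := hoff
  obtain ⟨t, ht, hta⟩ := hne
  exact hta (eq_left_of_stationary_off hT hγ hstat
    ⟨t₀, ht₀, fun h => ht₀M ((hMT _ (hγ.1 t₀ ht₀)).mpr h)⟩ t ht)

end

end Hyp

theorem mainTheorem2 (d : ℕ) (M : Set (EuclideanSpace ℝ (Fin d)))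
    (hM : Hyp.IsTotallyGeodesic M) :
    -- the closest-point projection is well defined
    (∀ x ∈ Hyp.ball d, Hyp.IsClosestPoint M x (Hyp.proj M x) ∧
      ∀ y, Hyp.IsClosestPoint M x y → y = Hyp.proj M x) ∧
    ∀ (a b : ℝ), a ≤ b → ∀ γ : ℝ → EuclideanSpace ℝ (Fin d),
      (Hyp.IsSmoothPath γ a b ∨ Hyp.IsGeodesicSegment γ a b) →
        -- the path and its projection are smooth, so that both lengths make sense
        Hyp.IsSmoothPath γ a b ∧ Hyp.IsSmoothPath (fun t => Hyp.proj M (γ t)) a b ∧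
        -- the bound, and its exponential form
        (∀ r : ℝ, 0 ≤ r → (∀ t ∈ Set.Icc a b, r ≤ Hyp.distTo (γ t) M) →
          Hyp.length (fun t => Hyp.proj M (γ t)) a b ≤ 1 / Real.cosh r * Hyp.length γ a b ∧
          Hyp.length (fun t => Hyp.proj M (γ t)) a b ≤
            2 * Real.exp (-r) * Hyp.length γ a b) ∧
        -- strict decrease for a non-constant path that is not contained in `M`
        ((∃ s ∈ Set.Icc a b, ∃ t ∈ Set.Icc a b, γ s ≠ γ t) →
          (∃ t ∈ Set.Icc a b, γ t ∉ M) →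
            Hyp.length (fun t => Hyp.proj M (γ t)) a b < Hyp.length γ a b) := by
  obtain ⟨T, P, hT, hMT⟩ := hM.exists_isLorProj
  have hMb := hM.2.1
  refine ⟨fun x hx => ?_, fun a b hab γ hγ => ?_⟩
  · rw [Hyp.proj_eq_foot hT hMb hMT hx]
    exact Hyp.isClosestPoint_foot hT hMb hMT hx
  have hs : Hyp.IsSmoothPath γ a b := hγ.elim id fun h => h.isSmoothPath hab
  refine ⟨hs, hs.proj hT hMb hMT, fun r hr hd => ?_, fun ⟨s, hsI, t, htI, hne⟩ hoff => ?_⟩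
  · have hmain := hs.length_proj_le hab hT hMb hMT hr hd
    refine ⟨hmain, hmain.trans (mul_le_mul_of_nonneg_right ?_ (hs.length_nonneg hab))⟩
    -- The exponential form follows from `2 * cosh r ≥ exp r`.
    rw [div_le_iff₀ (Real.cosh_pos r), Real.cosh_eq, Real.exp_neg]
    have := Real.exp_pos r
    field_simp
    nlinarith
  · have hlt : a < b := by
      refine hab.lt_of_ne fun h => hne ?_
      rw [le_antisymm (hsI.2.trans (h ▸ htI.1)) (htI.2.trans (h ▸ hsI.1))]
    refine hs.length_proj_lt hlt hT hMb hMT ?_ hoff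
    by_contra! hcon
    exact hne ((hcon s hsI).trans (hcon t htI).symm)
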